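/- Let $Y$ and $\psi$ be real-valued random variables on a common probability space, and let $q:\mathbb{R}\times\mathbb{R}\to\mathbb{R}$ be a known function such that $q(\cdot,c)$ is Borel measurable for every $c\in\mathbb{R}$. Write $x^+=\max(0,x)$, and write $U'\sim U$ if $U'$ and $U$ have the same distribution. Say that $\mathrm{H}_{0S}$ holds (rational expectations up to an aggregate shock can be rationalized) if there exist a pair of real-valued random variables $(Y',\psi')$ on some probability space, a sub-sigma-algebra $\mathcal{I}'$ of that space, and a number $c\in\mathbb{R}$ such that $$\sigma(\psi')\subset\mathcal{I}',\qquad Y'\sim Y,\qquad \psi'\sim\psi,\qquad \mathbb{E}\left[q(Y',c)\mid\mathcal{I}'\right]=\psi'\ \text{ almost surely.}$$ Assume that $\mathbb{E}|\psi|<\infty$, that $\mathbb{E}|q(Y,c)|<\infty$ for all $c\in\mathbb{R}$, and that the equation $\mathbb{E}[q(Y,c)]=\mathbb{E}[\psi]$ admits a unique solution $c=c_0\in\mathbb{R}$. Then the following statements are equivalent: (i) $\mathrm{H}_{0S}$ holds; (ii) $\mathbb{E}\left[(y-q(Y,c_0))^+-(y-\psi)^+\right]\ge 0$ for all $y\in\mathbb{R}$.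 -/

import Mathlib

open MeasureTheory ProbabilityTheory

/-- The null hypothesis "rational expectations up to an aggregate shock" for a known function
`q (y, c)`: there are a probability space `(Ω', mΩ', P')`, random variables `Y'`, `ψ'` on it, a
sub-sigma-algebra `I'` and a real number `c` such that `σ(ψ') ⊆ I'`, `Y' ∼ Y`, `ψ' ∼ ψ` and
`E[q(Y', c) | I'] = ψ'` almost surely.
(`I'` is bound before `mΩ'`, so that measurability and measures on `Ω'` refer to `mΩ'`.) -/
def RationalExpectationsUpToShock {Ω : Type*} [MeasurableSpace Ω] (P : Measure Ω)
    (q : ℝ → ℝ → ℝ) (Y ψ : Ω → ℝ) : Prop :=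
  ∃ (Ω' : Type) (I' mΩ' : MeasurableSpace Ω') (P' : Measure Ω') (Y' ψ' : Ω' → ℝ) (c : ℝ),
    IsProbabilityMeasure P' ∧ Measurable Y' ∧ Measurable ψ' ∧
    MeasurableSpace.comap ψ' inferInstance ≤ I' ∧ I' ≤ mΩ' ∧
    IdentDistrib Y' Y P' P ∧ IdentDistrib ψ' ψ P' P ∧
    P'[fun ω => q (Y' ω) c | I'] =ᵐ[P'] ψ'

/-! (i) ⇒ (ii): equality in law and the tower property give `E[q(Y, c)] = E[ψ]`, so `c = c₀`;
conditional Jensen for `x ↦ (y - x)⁺` concludes. (ii) ⇒ (i): with equal means, (ii) says that the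
law of `ψ` lies below that of `q(Y, c₀)` in convex order. Strassen's theorem
(`exists_martingale_coupling`) couples the two as a martingale, and disintegration lifts `q(Y, c₀)`
back to `Y`. Strassen's theorem is proved by an explicit coupling. With quantile functions `f`
(smaller law) and `g` (larger law) on `(0, 1)`, convex order gives `∫₀ᵘ g ≤ ∫₀ᵘ f`, so the measure
with density `(f - g)⁺` stochastically precedes the one with density `(g - f)⁺`. A monotone coupling
pairs points `x ≤ x'` with `g x < f x ≤ f x' < g x'`, and each of `f x`, `f x'` is split between `g
x` and `g x'` with its barycentric weights. -/

/-! ### Quantile functions and monotone couplings. -/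

open Filter Set Topology in
/-- Every finite measure on `ℝ` has a quantile function, the lower adjoint of its distribution
function. -/
theorem exists_quantile (M : Measure ℝ) [IsFiniteMeasure M] :
    ∃ Q : ℝ → ℝ, Measurable Q ∧
      ∀ t ∈ Set.Ioo 0 (M.real Set.univ), ∀ x, Q t ≤ x ↔ t ≤ M.real (Set.Iic x) := by
  have hmono : Monotone fun x => M.real (Iic x) := fun a b hab =>
    measureReal_mono (Iic_subset_Iic.2 hab)
  have htop : Tendsto (fun x => M.real (Iic x)) atTop (𝓝 (M.real univ)) :=
    (ENNReal.tendsto_toReal (measure_ne_top M _)).comp (tendsto_measure_Iic_atTop M)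
  have hbot : Tendsto (fun x => M.real (Iic x)) atBot (𝓝 0) := by
    have h : Tendsto (fun x => M (Iic x)) atBot (𝓝 (M (⋂ x : ℝ, Iic x))) :=
      tendsto_measure_iInter_atBot (fun _ => measurableSet_Iic.nullMeasurableSet)
        (fun a b hab => Iic_subset_Iic.2 hab) ⟨0, measure_ne_top M _⟩
    have h0 : (⋂ x : ℝ, Iic x) = ∅ := by
      ext y
      simp only [mem_iInter, mem_Iic, mem_empty_iff_false, iff_false, not_forall, not_le]
      exact exists_lt y
    rw [h0, measure_empty] at h
    exact (ENNReal.tendsto_toReal ENNReal.zero_ne_top).comp h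
  have hright : ∀ x : ℝ, Tendsto (fun n : ℕ => M.real (Iic (x + 1 / ((n : ℝ) + 1)))) atTop
      (𝓝 (M.real (Iic x))) := by
    intro x
    have h : Tendsto (fun n : ℕ => M (Iic (x + 1 / ((n : ℝ) + 1)))) atTop
        (𝓝 (M (⋂ n : ℕ, Iic (x + 1 / ((n : ℝ) + 1))))) :=
      tendsto_measure_iInter_atTop (fun _ => measurableSet_Iic.nullMeasurableSet)
        (fun a b hab => Iic_subset_Iic.2
          (add_le_add_right (one_div_le_one_div_of_le (by positivity) (by gcongr)) x))
        ⟨0, measure_ne_top M _⟩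
    have h0 : (⋂ n : ℕ, Iic (x + 1 / ((n : ℝ) + 1))) = Iic x := by
      ext y
      simp only [mem_iInter, mem_Iic]
      refine ⟨fun hy => le_of_forall_pos_lt_add fun ε hε => ?_, fun hy n => hy.trans ?_⟩
      · obtain ⟨n, hn⟩ := exists_nat_one_div_lt hε
        linarith [hy n]
      · have : (0 : ℝ) < 1 / ((n : ℝ) + 1) := by positivity
        linarith
    rw [h0] at h
    exact (ENNReal.tendsto_toReal (measure_ne_top M _)).comp h
  have hgalois : ∀ t ∈ Ioo 0 (M.real univ), ∀ x,
      sInf {x | t ≤ M.real (Iic x)} ≤ x ↔ t ≤ M.real (Iic x) := by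
    intro t ht x
    have hne : {x | t ≤ M.real (Iic x)}.Nonempty :=
      ((htop.eventually (eventually_gt_nhds ht.2)).exists).imp fun _ h => le_of_lt h
    have hbdd : BddBelow {x | t ≤ M.real (Iic x)} := by
      obtain ⟨b, hb⟩ := (hbot.eventually (eventually_lt_nhds ht.1)).exists
      refine ⟨b, fun y hy => le_of_not_gt fun hyb => ?_⟩
      exact absurd (hy.trans (hmono hyb.le)) (not_le.2 hb)
    refine ⟨fun h => ?_, fun h => csInf_le hbdd h⟩
    -- Right continuity of the distribution function makes the infimum attained.
    refine ge_of_tendsto' (hright x) fun n => ?_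
    have hn : (0 : ℝ) < 1 / ((n : ℝ) + 1) := by positivity
    obtain ⟨z, hz, hzx⟩ := exists_lt_of_csInf_lt hne (h.trans_lt (lt_add_of_pos_right x hn))
    exact le_trans hz (hmono hzx.le)
  -- Outside the open interval the set may be empty or unbounded below; the value there is set to
  -- `0`.
  refine ⟨(Ioo 0 (M.real univ)).indicator fun t => sInf {x | t ≤ M.real (Iic x)}, ?_, ?_⟩
  · refine measurable_of_Iic fun x => ?_
    have : (Ioo 0 (M.real univ)).indicator (fun t => sInf {x | t ≤ M.real (Iic x)}) ⁻¹' Iic x =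
        (Ioo 0 (M.real univ) ∩ Iic (M.real (Iic x))) ∪
          ((Ioo 0 (M.real univ))ᶜ ∩ {_t | (0 : ℝ) ≤ x}) := by
      ext t
      by_cases ht : t ∈ Ioo 0 (M.real univ)
      · simp only [mem_preimage, indicator_of_mem ht, mem_Iic, hgalois t ht x]
        simp [ht]
      · simp only [mem_preimage, indicator_of_notMem ht]
        simp [ht]
    rw [this]
    measurability
  · intro t ht x
    rw [indicator_of_mem ht]
    exact hgalois t ht x

/-- A quantile function pushes Lebesgue measure forward to the measure. -/
theorem map_quantile {M : Measure ℝ} [IsFiniteMeasure M] {Q : ℝ → ℝ} (hQ : Measurable Q)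
    (h : ∀ t ∈ Set.Ioo 0 (M.real Set.univ), ∀ x, Q t ≤ x ↔ t ≤ M.real (Set.Iic x)) :
    (volume.restrict (Set.Ioo 0 (M.real Set.univ))).map Q = M := by
  refine Measure.ext_of_Iic _ _ fun x => ?_
  rw [Measure.map_apply hQ measurableSet_Iic,
    Measure.restrict_apply (hQ measurableSet_Iic)]
  have hle : M.real (Set.Iic x) ≤ M.real Set.univ := measureReal_mono (Set.subset_univ _)
  have hset : Q ⁻¹' Set.Iic x ∩ Set.Ioo 0 (M.real Set.univ) =
      Set.Iic (M.real (Set.Iic x)) ∩ Set.Ioo 0 (M.real Set.univ) := by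
    ext t
    simp only [Set.mem_inter_iff, Set.mem_preimage, Set.mem_Iic, and_congr_left_iff]
    exact fun ht => h t ht x
  rw [hset]
  refine le_antisymm ?_ ?_
  · calc volume (Set.Iic (M.real (Set.Iic x)) ∩ Set.Ioo 0 (M.real Set.univ))
        ≤ volume (Set.Ioc 0 (M.real (Set.Iic x))) :=
          measure_mono fun t ht => ⟨ht.2.1, ht.1⟩
      _ = M (Set.Iic x) := by rw [Real.volume_Ioc, sub_zero, ofReal_measureReal]
  · calc M (Set.Iic x) = volume (Set.Ioo 0 (M.real (Set.Iic x))) := by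
          rw [Real.volume_Ioo, sub_zero, ofReal_measureReal]
      _ ≤ volume (Set.Iic (M.real (Set.Iic x)) ∩ Set.Ioo 0 (M.real Set.univ)) :=
          measure_mono fun t ht => ⟨ht.2.le, ht.1, ht.2.trans_le hle⟩

/-- Two finite measures of the same mass that are stochastically ordered have a monotone
coupling. -/
theorem exists_monotone_coupling (M N : Measure ℝ) [IsFiniteMeasure M] [IsFiniteMeasure N]
    (hmass : M Set.univ = N Set.univ) (hle : ∀ x, N (Set.Iic x) ≤ M (Set.Iic x)) :
    ∃ π : Measure (ℝ × ℝ), π.map Prod.fst = M ∧ π.map Prod.snd = N ∧ ∀ᵐ p ∂π, p.1 ≤ p.2 := by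
  obtain ⟨Q, hQ, hQM⟩ := exists_quantile M
  obtain ⟨R, hR, hRN⟩ := exists_quantile N
  have hreal : N.real Set.univ = M.real Set.univ := by simp [measureReal_def, hmass]
  have hRN' := map_quantile hR hRN
  rw [hreal] at hRN hRN'
  -- Both quantile functions are evaluated at the same uniform point.
  refine ⟨(volume.restrict (Set.Ioo 0 (M.real Set.univ))).map fun t => (Q t, R t), ?_, ?_, ?_⟩
  · rw [Measure.map_map measurable_fst (by fun_prop)]
    exact map_quantile hQ hQM
  · rw [Measure.map_map measurable_snd (by fun_prop)]
    exact hRN'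
  · rw [ae_map_iff (by fun_prop) (measurableSet_le measurable_fst measurable_snd)]
    filter_upwards [ae_restrict_mem measurableSet_Ioo] with t ht
    rw [hQM t ht]
    exact ((hRN t ht _).1 le_rfl).trans
      (ENNReal.toReal_mono (measure_ne_top _ _) (hle _))

/-! ### Reweighting by reciprocal densities. -/

/-- If `e` pushes `π` forward to the positive part of `d` times `lam`, integrating against `1 / d`
recovers `lam` on `{0 < d}`. -/
theorem lintegral_one_div_density {X : Type*} [MeasurableSpace X] {lam : Measure ℝ}
    {π : Measure X} {d : ℝ → ℝ} (hd : Measurable d) {e : X → ℝ} (he : Measurable e)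
    (hπ : π.map e = lam.withDensity fun x => ENNReal.ofReal (d x))
    {k : ℝ → ENNReal} (hk : Measurable k) :
    ∫⁻ x, ENNReal.ofReal (1 / d (e x)) * k (e x) ∂π = ∫⁻ x in {x | 0 < d x}, k x ∂lam := by
  have hmeas : Measurable fun x => ENNReal.ofReal (1 / d x) * k x := by fun_prop
  rw [← lintegral_map hmeas he, hπ, lintegral_withDensity_eq_lintegral_mul _ (by fun_prop) hmeas,
    ← lintegral_indicator (measurableSet_lt measurable_const hd)]
  refine lintegral_congr fun x => ?_
  by_cases hx : 0 < d x
  · rw [Set.indicator_of_mem (by exact hx), Pi.mul_apply, ← mul_assoc,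
      ← ENNReal.ofReal_mul hx.le, mul_one_div_cancel hx.ne', ENNReal.ofReal_one, one_mul]
  · rw [Set.indicator_of_notMem (by exact hx), Pi.mul_apply,
      ENNReal.ofReal_of_nonpos (not_lt.1 hx), zero_mul]

/-- The sets `f = g`, `g < f` and `f < g` partition the line. This identity yields both marginals of
the martingale coupling. -/
theorem lintegral_eq_add_lintegral_one_div_sub {lam : Measure ℝ} {π : Measure (ℝ × ℝ)}
    {f g : ℝ → ℝ} (hf : Measurable f) (hg : Measurable g)
    (hM : π.map Prod.fst = lam.withDensity fun x => ENNReal.ofReal (f x - g x))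
    (hN : π.map Prod.snd = lam.withDensity fun x => ENNReal.ofReal (g x - f x))
    {k : ℝ → ENNReal} (hk : Measurable k) :
    ∫⁻ x in {x | f x = g x}, k x ∂lam +
      (∫⁻ p, ENNReal.ofReal (1 / (f p.1 - g p.1)) * k p.1 ∂π +
        ∫⁻ p, ENNReal.ofReal (1 / (g p.2 - f p.2)) * k p.2 ∂π) = ∫⁻ x, k x ∂lam := by
  have l1 := lintegral_one_div_density (hf.sub hg) measurable_fst hM hk
  have l2 := lintegral_one_div_density (hg.sub hf) measurable_snd hN hk
  simp only [Pi.sub_apply] at l1 l2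
  rw [l1, l2]
  have h1 : MeasurableSet {x | f x = g x} := measurableSet_eq_fun hf hg
  have h2 : MeasurableSet {x | 0 < f x - g x} := measurableSet_lt measurable_const (hf.sub hg)
  have h3 : MeasurableSet {x | 0 < g x - f x} := measurableSet_lt measurable_const (hg.sub hf)
  rw [← lintegral_indicator h1, ← lintegral_indicator h2, ← lintegral_indicator h3,
    ← lintegral_add_left (hk.indicator h2), ← lintegral_add_left (hk.indicator h1)]
  refine lintegral_congr fun x => ?_
  rcases lt_trichotomy (f x) (g x) with h | h | h
  · simp [Set.indicator, h, h.ne, h.not_gt]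
  · simp [Set.indicator, h]
  · simp [Set.indicator, h, h.ne', h.not_gt]

theorem lintegral_map_withDensity {X Y : Type*} [MeasurableSpace X] [MeasurableSpace Y]
    {π : Measure X} {w : X → ℝ} (hw : Measurable w) {G : X → Y} (hG : Measurable G)
    {h : Y → ENNReal} (hh : Measurable h) :
    ∫⁻ y, h y ∂(π.withDensity fun x => ENNReal.ofReal (w x)).map G =
      ∫⁻ x, ENNReal.ofReal (w x) * h (G x) ∂π := by
  rw [lintegral_map hh hG,
    lintegral_withDensity_eq_lintegral_mul _ (by fun_prop) (by fun_prop)]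
  rfl

theorem integral_map_withDensity {X Y : Type*} [MeasurableSpace X] [MeasurableSpace Y]
    {π : Measure X} {w : X → ℝ} (hw : Measurable w) (hw0 : ∀ᵐ x ∂π, 0 ≤ w x)
    {G : X → Y} (hG : Measurable G) {h : Y → ℝ} (hh : Measurable h) :
    ∫ y, h y ∂(π.withDensity fun x => ENNReal.ofReal (w x)).map G =
      ∫ x, w x * h (G x) ∂π := by
  rw [integral_map hG.aemeasurable hh.aestronglyMeasurable,
    integral_withDensity_eq_integral_toReal_smul (by fun_prop)
      (Filter.Eventually.of_forall fun _ => ENNReal.ofReal_lt_top)]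
  refine integral_congr_ae ?_
  filter_upwards [hw0] with x hx
  rw [ENNReal.toReal_ofReal hx, smul_eq_mul]

theorem integrable_of_integrable_map_withDensity {X Y : Type*} [MeasurableSpace X]
    [MeasurableSpace Y] {π : Measure X} {w : X → ℝ} (hw : Measurable w)
    (hw0 : ∀ᵐ x ∂π, 0 ≤ w x) {G : X → Y} (hG : Measurable G) {h : Y → ℝ} (hh : Measurable h)
    (hint : Integrable h ((π.withDensity fun x => ENNReal.ofReal (w x)).map G)) :
    Integrable (fun x => w x * h (G x)) π := by
  rw [integrable_map_measure hh.aestronglyMeasurable hG.aemeasurable,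
    integrable_withDensity_iff_integrable_smul' (by fun_prop)
      (Filter.Eventually.of_forall fun _ => ENNReal.ofReal_lt_top)] at hint
  refine hint.congr ?_
  filter_upwards [hw0] with x hx
  rw [ENNReal.toReal_ofReal hx, smul_eq_mul, Function.comp]

/-! ### Strassen's theorem through quantile functions. -/

/-- **Inverse transform martingale coupling**: if `f` and `g` have the same integral, the integrals
of `g` over initial intervals are at most those of `f`, and `f` is nondecreasing, then the laws of
`g` and `f` are the marginals of a martingale coupling. -/
theorem exists_martingale_coupling_of_monotoneOn (lam : Measure ℝ) [IsFiniteMeasure lam]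
    {f g : ℝ → ℝ} (hf : Measurable f) (hg : Measurable g) (hfi : Integrable f lam)
    (hgi : Integrable g lam) {T : Set ℝ} (hT : ∀ᵐ x ∂lam, x ∈ T) (hmono : MonotoneOn f T)
    (heq : ∫ x, g x ∂lam = ∫ x, f x ∂lam)
    (hle : ∀ u, ∫ x in Set.Iic u, g x ∂lam ≤ ∫ x in Set.Iic u, f x ∂lam) :
    ∃ Γ : Measure (ℝ × ℝ), Γ.map Prod.fst = lam.map g ∧ Γ.map Prod.snd = lam.map f ∧
      ∀ B, MeasurableSet B → ∫ p in Prod.snd ⁻¹' B, (p.1 - p.2) ∂Γ = 0 := by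
  set M := lam.withDensity fun x => ENNReal.ofReal (f x - g x) with hMdef
  set N := lam.withDensity fun x => ENNReal.ofReal (g x - f x) with hNdef
  have hfg : Integrable (fun x => f x - g x) lam := hfi.sub hgi
  have hgf : Integrable (fun x => g x - f x) lam := hgi.sub hfi
  have hMfin : IsFiniteMeasure M := isFiniteMeasure_withDensity_ofReal hfg.2
  have hNfin : IsFiniteMeasure N := isFiniteMeasure_withDensity_ofReal hgf.2
  have hdiff : ∀ s, MeasurableSet s →
      ∫ x in s, f x ∂lam - ∫ x in s, g x ∂lam = (M s).toReal - (N s).toReal := by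
    intro s hs
    rw [← integral_sub hfi.integrableOn hgi.integrableOn,
      integral_eq_lintegral_pos_part_sub_lintegral_neg_part hfg.integrableOn, hMdef, hNdef,
      withDensity_apply _ hs, withDensity_apply _ hs]
    simp only [neg_sub]
  obtain ⟨π, hπ1, hπ2, hπle⟩ := exists_monotone_coupling M N
    (by
      have h := hdiff Set.univ MeasurableSet.univ
      rw [Measure.restrict_univ, heq, sub_self] at h
      exact (ENNReal.toReal_eq_toReal_iff' (measure_ne_top _ _) (measure_ne_top _ _)).1
        (sub_eq_zero.1 h.symm))
    (fun u => by
      have h := hdiff (Set.Iic u) measurableSet_Iic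
      exact (ENNReal.toReal_le_toReal (measure_ne_top _ _) (measure_ne_top _ _)).1
        (by linarith [hle u]))
  have hfst : ∀ᵐ p ∂π, g p.1 < f p.1 ∧ p.1 ∈ T := by
    have h : ∀ᵐ x ∂M, g x < f x ∧ x ∈ T := by
      rw [hMdef, ae_withDensity_iff (by fun_prop)]
      filter_upwards [hT] with x hx h0
      exact ⟨by simpa using h0, hx⟩
    rw [← hπ1] at h
    exact ae_of_ae_map measurable_fst.aemeasurable h
  have hsnd : ∀ᵐ p ∂π, f p.2 < g p.2 ∧ p.2 ∈ T := by
    have h : ∀ᵐ x ∂N, f x < g x ∧ x ∈ T := by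
      rw [hNdef, ae_withDensity_iff (by fun_prop)]
      filter_upwards [hT] with x hx h0
      exact ⟨by simpa using h0, hx⟩
    rw [← hπ2] at h
    exact ae_of_ae_map measurable_snd.aemeasurable h
  have hord : ∀ᵐ p ∂π, g p.1 < f p.1 ∧ f p.1 ≤ f p.2 ∧ f p.2 < g p.2 := by
    filter_upwards [hfst, hsnd, hπle] with p h1 h2 h3
    exact ⟨h1.1, hmono h1.2 h2.2 h3, h2.1⟩
  -- The total weights `a` at `f p.1` and `b` at `f p.2` undo the densities. Sending weight `m` to
  -- the opposite value of `g` and the rest to its own centres each split; since `m` is common to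
  -- both, the totals at `g p.1` and `g p.2` remain `a` and `b`.
  let m : ℝ × ℝ → ℝ := fun p => 1 / (g p.2 - g p.1)
  let a : ℝ × ℝ → ℝ := fun p => 1 / (f p.1 - g p.1)
  let b : ℝ × ℝ → ℝ := fun p => 1 / (g p.2 - f p.2)
  have hm : Measurable m := by fun_prop
  have ha : Measurable a := by fun_prop
  have hb : Measurable b := by fun_prop
  have hm0 : ∀ᵐ p ∂π, 0 ≤ m p := by
    filter_upwards [hord] with p ⟨h1, h2, h3⟩
    exact one_div_nonneg.2 (by linarith)
  have ham0 : ∀ᵐ p ∂π, 0 ≤ a p - m p := by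
    filter_upwards [hord] with p ⟨h1, h2, h3⟩
    exact sub_nonneg.2 (one_div_le_one_div_of_le (by linarith) (by linarith))
  have hbm0 : ∀ᵐ p ∂π, 0 ≤ b p - m p := by
    filter_upwards [hord] with p ⟨h1, h2, h3⟩
    exact sub_nonneg.2 (one_div_le_one_div_of_le (by linarith) (by linarith))
  let K : (ℝ × ℝ → ℝ) → (ℝ × ℝ → ℝ × ℝ) → Measure (ℝ × ℝ) := fun w G =>
    (π.withDensity fun p => ENNReal.ofReal (w p)).map G
  let Γ₀ : Measure (ℝ × ℝ) := (lam.restrict {x | f x = g x}).map fun x => (g x, f x)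
  let Γ₁ := K (fun p => a p - m p) fun p => (g p.1, f p.1)
  let Γ₂ := K m fun p => (g p.2, f p.1)
  let Γ₃ := K (fun p => b p - m p) fun p => (g p.2, f p.2)
  let Γ₄ := K m fun p => (g p.1, f p.2)
  have hlint : ∀ h : ℝ × ℝ → ENNReal, Measurable h →
      ∫⁻ z, h z ∂(Γ₀ + (Γ₁ + Γ₂ + (Γ₃ + Γ₄))) = ∫⁻ x in {x | f x = g x}, h (g x, f x) ∂lam +
        ∫⁻ p, (ENNReal.ofReal (a p - m p) * h (g p.1, f p.1) +
          ENNReal.ofReal (m p) * h (g p.2, f p.1) +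
          (ENNReal.ofReal (b p - m p) * h (g p.2, f p.2) +
          ENNReal.ofReal (m p) * h (g p.1, f p.2))) ∂π := by
    intro h hh
    rw [lintegral_add_measure, lintegral_add_measure, lintegral_add_measure,
      lintegral_add_measure, lintegral_map hh (by fun_prop),
      lintegral_map_withDensity (by fun_prop) (by fun_prop) hh,
      lintegral_map_withDensity (by fun_prop) (by fun_prop) hh,
      lintegral_map_withDensity (by fun_prop) (by fun_prop) hh,
      lintegral_map_withDensity (by fun_prop) (by fun_prop) hh,
      lintegral_add_left (by fun_prop), lintegral_add_left (by fun_prop),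
      lintegral_add_left (by fun_prop)]
  have hsum : ∀ {x y : ℝ}, 0 ≤ x - y → 0 ≤ y →
      ENNReal.ofReal (x - y) + ENNReal.ofReal y = ENNReal.ofReal x := by
    intro x y h1 h2
    rw [← ENNReal.ofReal_add h1 h2, sub_add_cancel]
  have hΓfst : (Γ₀ + (Γ₁ + Γ₂ + (Γ₃ + Γ₄))).map Prod.fst = lam.map g := by
    refine Measure.ext_of_lintegral _ fun h hh => ?_
    rw [lintegral_map hh measurable_fst, hlint _ (by fun_prop), lintegral_map hh hg,
      ← lintegral_eq_add_lintegral_one_div_sub hf hg hπ1 hπ2 (k := fun x => h (g x)) (by fun_prop),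
      ← lintegral_add_left (by fun_prop)]
    congr 1
    refine lintegral_congr_ae ?_
    filter_upwards [hm0, ham0, hbm0] with p h1 h2 h3
    change _ = ENNReal.ofReal (a p) * h (g p.1) + ENNReal.ofReal (b p) * h (g p.2)
    rw [← hsum h2 h1, ← hsum h3 h1]
    ring
  have hΓsnd : (Γ₀ + (Γ₁ + Γ₂ + (Γ₃ + Γ₄))).map Prod.snd = lam.map f := by
    refine Measure.ext_of_lintegral _ fun h hh => ?_
    rw [lintegral_map hh measurable_snd, hlint _ (by fun_prop), lintegral_map hh hf,
      ← lintegral_eq_add_lintegral_one_div_sub hf hg hπ1 hπ2 (k := fun x => h (f x)) (by fun_prop),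
      ← lintegral_add_left (by fun_prop)]
    congr 1
    refine lintegral_congr_ae ?_
    filter_upwards [hm0, ham0, hbm0] with p h1 h2 h3
    change _ = ENNReal.ofReal (a p) * h (f p.1) + ENNReal.ofReal (b p) * h (f p.2)
    rw [← hsum h2 h1, ← hsum h3 h1]
    ring
  refine ⟨Γ₀ + (Γ₁ + Γ₂ + (Γ₃ + Γ₄)), hΓfst, hΓsnd, fun B hB => ?_⟩
  have hi1 : Integrable (fun p : ℝ × ℝ => p.1) (Γ₀ + (Γ₁ + Γ₂ + (Γ₃ + Γ₄))) := by
    refine Integrable.comp_measurable (g := id) ?_ measurable_fst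
    rw [hΓfst]
    exact (integrable_map_measure measurable_id.aestronglyMeasurable hg.aemeasurable).2 hgi
  have hi2 : Integrable (fun p : ℝ × ℝ => p.2) (Γ₀ + (Γ₁ + Γ₂ + (Γ₃ + Γ₄))) := by
    refine Integrable.comp_measurable (g := id) ?_ measurable_snd
    rw [hΓsnd]
    exact (integrable_map_measure measurable_id.aestronglyMeasurable hf.aemeasurable).2 hfi
  let φ : ℝ × ℝ → ℝ := (Prod.snd ⁻¹' B).indicator fun p => p.1 - p.2
  have hB' : MeasurableSet (Prod.snd ⁻¹' B : Set (ℝ × ℝ)) := measurable_snd hB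
  have hφ : Measurable φ := (measurable_fst.sub measurable_snd).indicator hB'
  have hφi : Integrable φ (Γ₀ + (Γ₁ + Γ₂ + (Γ₃ + Γ₄))) := (hi1.sub hi2).indicator hB'
  obtain ⟨hφ0, hφ'⟩ := integrable_add_measure.1 hφi
  obtain ⟨hφ12, hφ34⟩ := integrable_add_measure.1 hφ'
  obtain ⟨hφ1, hφ2⟩ := integrable_add_measure.1 hφ12
  obtain ⟨hφ3, hφ4⟩ := integrable_add_measure.1 hφ34
  have j1 := integrable_of_integrable_map_withDensity (by fun_prop) ham0 (by fun_prop) hφ hφ1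
  have j2 := integrable_of_integrable_map_withDensity (by fun_prop) hm0 (by fun_prop) hφ hφ2
  have j3 := integrable_of_integrable_map_withDensity (by fun_prop) hbm0 (by fun_prop) hφ hφ3
  have j4 := integrable_of_integrable_map_withDensity (by fun_prop) hm0 (by fun_prop) hφ hφ4
  rw [← integral_indicator hB']
  change ∫ p, φ p ∂_ = 0
  rw [integral_add_measure hφ0 hφ', integral_add_measure hφ12 hφ34,
    integral_add_measure hφ1 hφ2, integral_add_measure hφ3 hφ4,
    integral_map (by fun_prop) hφ.aestronglyMeasurable,
    integral_map_withDensity (by fun_prop) ham0 (by fun_prop) hφ,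
    integral_map_withDensity (by fun_prop) hm0 (by fun_prop) hφ,
    integral_map_withDensity (by fun_prop) hbm0 (by fun_prop) hφ,
    integral_map_withDensity (by fun_prop) hm0 (by fun_prop) hφ,
    ← integral_add j1 j2, ← integral_add j3 j4]
  have e0 : ∫ x in {x | f x = g x}, φ (g x, f x) ∂lam = 0 := by
    refine integral_eq_zero_of_ae ?_
    filter_upwards [ae_restrict_mem (measurableSet_eq_fun hf hg)] with x hx
    have hx' : f x = g x := hx
    simp [φ, Set.indicator, hx']
  -- Both terms have second coordinate `f p.1`, so they lie in `B` together and their deviations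
  -- cancel.
  have e1 : ∫ p, ((a p - m p) * φ (g p.1, f p.1) + m p * φ (g p.2, f p.1)) ∂π = 0 := by
    refine integral_eq_zero_of_ae ?_
    filter_upwards [hord] with p ⟨h1, h2, h3⟩
    by_cases hp : f p.1 ∈ B
    · have d1 : f p.1 - g p.1 ≠ 0 := by linarith
      have d2 : g p.2 - g p.1 ≠ 0 := by linarith
      simp only [φ, a, m, Set.indicator, Set.mem_preimage, hp, if_true, Pi.zero_apply]
      field_simp
      ring
    · simp [φ, hp]
  have e2 : ∫ p, ((b p - m p) * φ (g p.2, f p.2) + m p * φ (g p.1, f p.2)) ∂π = 0 := by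
    refine integral_eq_zero_of_ae ?_
    filter_upwards [hord] with p ⟨h1, h2, h3⟩
    by_cases hp : f p.2 ∈ B
    · have d1 : g p.2 - f p.2 ≠ 0 := by linarith
      have d2 : g p.2 - g p.1 ≠ 0 := by linarith
      simp only [φ, b, m, Set.indicator, Set.mem_preimage, hp, if_true, Pi.zero_apply]
      field_simp
      ring
    · simp [φ, hp]
  rw [e0, e1, e2, add_zero, add_zero]

/-- **Strassen's theorem** on the real line: two integrable probability measures in convex order
are the marginals of a martingale coupling. -/
theorem exists_martingale_coupling (μ ν : Measure ℝ) [IsProbabilityMeasure μ]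
    [IsProbabilityMeasure ν] (hμ : Integrable id μ) (hν : Integrable id ν)
    (hmean : ∫ x, x ∂ν = ∫ x, x ∂μ)
    (hcx : ∀ y, ∫ x, max 0 (y - x) ∂μ ≤ ∫ x, max 0 (y - x) ∂ν) :
    ∃ Γ : Measure (ℝ × ℝ), Γ.map Prod.fst = ν ∧ Γ.map Prod.snd = μ ∧
      ∀ B, MeasurableSet B → ∫ p in Prod.snd ⁻¹' B, (p.1 - p.2) ∂Γ = 0 := by
  obtain ⟨f, hf, hfμ⟩ := exists_quantile μ
  obtain ⟨g, hg, hgν⟩ := exists_quantile ν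
  have hmapf := map_quantile hf hfμ
  have hmapg := map_quantile hg hgν
  rw [probReal_univ] at hmapf hmapg hfμ hgν
  set lam : Measure ℝ := volume.restrict (Set.Ioo 0 1) with hlam
  have hmem : ∀ᵐ x ∂lam, x ∈ Set.Ioo (0 : ℝ) 1 := ae_restrict_mem measurableSet_Ioo
  have hfi : Integrable f lam :=
    (integrable_map_measure (g := id) (by fun_prop) hf.aemeasurable).1 (hmapf ▸ hμ)
  have hgi : Integrable g lam :=
    (integrable_map_measure (g := id) (by fun_prop) hg.aemeasurable).1 (hmapg ▸ hν)
  have hfmono : MonotoneOn f (Set.Ioo 0 1) := fun s hs t ht hst =>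
    (hfμ s hs _).2 (hst.trans ((hfμ t ht _).1 le_rfl))
  have hgmono : MonotoneOn g (Set.Ioo 0 1) := fun s hs t ht hst =>
    (hgν s hs _).2 (hst.trans ((hgν t ht _).1 le_rfl))
  have heq : ∫ x, g x ∂lam = ∫ x, f x ∂lam := by
    rw [← hmapf, ← hmapg, integral_map hf.aemeasurable (by fun_prop),
      integral_map hg.aemeasurable (by fun_prop)] at hmean
    exact hmean
  have hcx' : ∀ y, ∫ x, max 0 (y - f x) ∂lam ≤ ∫ x, max 0 (y - g x) ∂lam := by
    intro y
    have h := hcx y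
    rw [← hmapf, ← hmapg, integral_map hf.aemeasurable (by fun_prop),
      integral_map hg.aemeasurable (by fun_prop)] at h
    exact h
  have hle : ∀ u, ∫ x in Set.Iic u, g x ∂lam ≤ ∫ x in Set.Iic u, f x ∂lam := by
    intro u
    rcases le_or_gt u 0 with hu0 | hu0
    · have : lam.restrict (Set.Iic u) = 0 := by
        rw [hlam, Measure.restrict_restrict measurableSet_Iic, Set.disjoint_iff_inter_eq_empty.1,
          Measure.restrict_empty]
        exact Set.disjoint_left.2 fun x hx hx' => absurd (hx'.1.trans_le hx) (not_lt.2 hu0)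
      simp [this]
    rcases le_or_gt 1 u with hu1 | hu1
    · have : lam.restrict (Set.Iic u) = lam := by
        rw [hlam, Measure.restrict_restrict measurableSet_Iic, Set.inter_eq_right.2]
        exact fun x hx => hx.2.le.trans hu1
      rw [this, heq]
    -- Test the convex order at `y = g u`: by monotonicity `(g u - g)⁺` lives exactly on `x ≤ u`,
    -- while for `f` truncating to `x ≤ u` gives an inequality in the needed direction.
    have hu : u ∈ Set.Ioo (0 : ℝ) 1 := ⟨hu0, hu1⟩
    have hfy : Integrable (fun x => f x - g u) lam := hfi.sub (integrable_const _)
    have hgy : Integrable (fun x => g x - g u) lam := hgi.sub (integrable_const _)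
    have h1 : ∫ x in Set.Iic u, (g x - g u) ∂lam = -∫ x, max 0 (g u - g x) ∂lam := by
      rw [← integral_neg, ← integral_indicator measurableSet_Iic]
      refine integral_congr_ae ?_
      filter_upwards [hmem] with x hx
      by_cases hxu : x ≤ u
      · rw [Set.indicator_of_mem (by exact hxu),
          max_eq_right (sub_nonneg.2 (hgmono hx hu hxu)), neg_sub]
      · rw [Set.indicator_of_notMem (by exact hxu),
          max_eq_left (sub_nonpos.2 (hgmono hu hx (not_le.1 hxu).le)), neg_zero]
    have h2 : -∫ x, max 0 (g u - f x) ∂lam ≤ ∫ x in Set.Iic u, (f x - g u) ∂lam := by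
      rw [← integral_neg, ← integral_indicator measurableSet_Iic]
      refine integral_mono ?_ (hfy.indicator measurableSet_Iic) fun x => ?_
      · have : Integrable (fun x => g u - f x) lam := (integrable_const _).sub hfi
        exact ((integrable_const 0).sup this).neg
      · change -max 0 (g u - f x) ≤ _
        by_cases hxu : x ≤ u
        · rw [Set.indicator_of_mem (by exact hxu)]
          linarith [le_max_right 0 (g u - f x)]
        · rw [Set.indicator_of_notMem (by exact hxu)]
          linarith [le_max_left 0 (g u - f x)]
    have h3 := hcx' (g u)
    rw [integral_sub hgi.integrableOn (integrable_const _)] at h1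
    rw [integral_sub hfi.integrableOn (integrable_const _)] at h2
    linarith
  obtain ⟨Γ, hΓ1, hΓ2, hΓ⟩ := exists_martingale_coupling_of_monotoneOn lam hf hg hfi hgi hmem
    hfmono heq hle
  exact ⟨Γ, hΓ1.trans hmapg, hΓ2.trans hmapf, hΓ⟩

/-! ### From the coupling to conditional expectations. -/

/-- If `ρ` is a probability measure with image `Γ.map Prod.fst` under `r`, then `Γ` is the image
under `r × id` of a measure whose first marginal is `ρ`. -/
theorem exists_lift_of_map_eq_map_fst (ρ : Measure ℝ) [IsProbabilityMeasure ρ] {r : ℝ → ℝ}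
    (hr : Measurable r) (Γ : Measure (ℝ × ℝ)) (hΓ : Γ.map Prod.fst = ρ.map r) :
    ∃ P' : Measure (ℝ × ℝ), IsProbabilityMeasure P' ∧ P'.map Prod.fst = ρ ∧
      P'.map (Prod.map r id) = Γ := by
  have hprob : IsProbabilityMeasure (Γ.map Prod.fst) :=
    hΓ ▸ Measure.isProbabilityMeasure_map hr.aemeasurable
  have hΓprob : IsProbabilityMeasure Γ := Measure.isProbabilityMeasure_of_map Prod.fst
  -- Draw `y` from `ρ`, then the second coordinate from the conditional law under `Γ` given first
  -- coordinate `r y`.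
  refine ⟨ρ ⊗ₘ (Γ.condKernel.comap r hr), inferInstance, ?_, ?_⟩
  · exact Measure.fst_compProd _ _
  · ext s hs
    rw [Measure.map_apply (by fun_prop) hs,
      Measure.compProd_apply ((hr.prodMap measurable_id) hs)]
    conv_rhs => rw [← Γ.disintegrate Γ.condKernel, Measure.compProd_apply hs, Measure.fst, hΓ,
      lintegral_map (Kernel.measurable_kernel_prodMk_left hs) hr]
    rfl

theorem condExp_comap_snd_eq {P' : Measure (ℝ × ℝ)} [IsProbabilityMeasure P'] {r : ℝ → ℝ}
    (hr : Measurable r) (h1 : Integrable (fun p => r p.1) P')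
    (h2 : Integrable (fun p => p.2) P')
    (h : ∀ B, MeasurableSet B → ∫ p in Prod.snd ⁻¹' B, (p.1 - p.2) ∂(P'.map (Prod.map r id)) = 0) :
    P'[fun p => r p.1 | MeasurableSpace.comap Prod.snd inferInstance] =ᵐ[P'] Prod.snd := by
  refine (ae_eq_condExp_of_forall_setIntegral_eq measurable_snd.comap_le h1
    (fun s _ _ => h2.integrableOn) ?_ ?_).symm
  · rintro s ⟨B, hB, rfl⟩ -
    have hB' := h B hB
    rw [setIntegral_map (measurable_snd hB) (by fun_prop) (by fun_prop)] at hB'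
    have hint := integral_sub h1.integrableOn (h2.integrableOn (s := Prod.snd ⁻¹' B))
    exact (sub_eq_zero.1 (hint.symm.trans hB')).symm
  · exact (comap_measurable Prod.snd).aestronglyMeasurable

/-! ### Jensen's inequality and the equivalence. -/

theorem convexOn_max_zero_const_sub (y : ℝ) : ConvexOn ℝ Set.univ fun x : ℝ => max 0 (y - x) :=
  (convexOn_const 0 convex_univ).sup ((convexOn_const y convex_univ).sub
    (concaveOn_id convex_univ))

theorem MeasureTheory.Integrable.max_zero_const_sub {α : Type*} [MeasurableSpace α] {μ : Measure α}
    [IsFiniteMeasure μ] {X : α → ℝ} (hX : Integrable X μ) (y : ℝ) :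
    Integrable (fun ω => max 0 (y - X ω)) μ :=
  (integrable_const 0).sup ((integrable_const y).sub hX)

/-- Taking a conditional expectation decreases in the convex order. -/
theorem integral_max_zero_sub_le_of_condExp_eq {α : Type*} {m mα : MeasurableSpace α}
    {μ : Measure α} [IsProbabilityMeasure μ] (hm : m ≤ mα) {Z X : α → ℝ} (hZ : Integrable Z μ)
    (h : μ[Z | m] =ᵐ[μ] X) (y : ℝ) :
    ∫ ω, max 0 (y - X ω) ∂μ ≤ ∫ ω, max 0 (y - Z ω) ∂μ := by
  have hX : Integrable X μ := integrable_condExp.congr h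
  have hcont : Continuous fun x : ℝ => max 0 (y - x) := by fun_prop
  have hJ := (convexOn_max_zero_const_sub y).map_condExp_le hm
    (hcont.lowerSemicontinuous.lowerSemicontinuousOn _)
    (Filter.Eventually.of_forall fun _ => Set.mem_univ _) isClosed_univ hZ
    (hZ.max_zero_const_sub y)
  rw [← integral_condExp hm (f := fun ω => max 0 (y - Z ω))]
  refine integral_mono_ae (hX.max_zero_const_sub y) integrable_condExp ?_
  filter_upwards [hJ, h] with ω h1 h2
  rw [Function.comp_apply, h2] at h1
  exact h1

theorem mainTheorem5 {Ω : Type*} [MeasurableSpace Ω] (P : Measure Ω) [IsProbabilityMeasure P]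
    (Y ψ : Ω → ℝ) (hY : Measurable Y) (hψ : Measurable ψ)
    (q : ℝ → ℝ → ℝ) (hq : ∀ c : ℝ, Measurable fun y => q y c)
    (hψ_int : Integrable ψ P)
    (hq_int : ∀ c : ℝ, Integrable (fun ω => q (Y ω) c) P)
    (c₀ : ℝ) (hc₀ : ∫ ω, q (Y ω) c₀ ∂P = ∫ ω, ψ ω ∂P)
    (hc₀_unique : ∀ c : ℝ, ∫ ω, q (Y ω) c ∂P = ∫ ω, ψ ω ∂P → c = c₀) :
    RationalExpectationsUpToShock P q Y ψ ↔
      ∀ y : ℝ, 0 ≤ ∫ ω, (max 0 (y - q (Y ω) c₀) - max 0 (y - ψ ω)) ∂P := by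
  have hsub : ∀ y : ℝ, ∫ ω, (max 0 (y - q (Y ω) c₀) - max 0 (y - ψ ω)) ∂P =
      ∫ ω, max 0 (y - q (Y ω) c₀) ∂P - ∫ ω, max 0 (y - ψ ω) ∂P := fun y =>
    integral_sub ((hq_int c₀).max_zero_const_sub y) (hψ_int.max_zero_const_sub y)
  constructor
  · rintro ⟨Ω', I', mΩ', P', Y', ψ', c, hP', -, -, -, hI', hYY, hψψ, hcond⟩ y
    have hqY : IdentDistrib (fun ω => q (Y' ω) c) (fun ω => q (Y ω) c) P' P := hYY.comp (hq c)
    have hqi : Integrable (fun ω => q (Y' ω) c) P' := hqY.integrable_iff.2 (hq_int c)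
    have hc : c = c₀ := by
      refine hc₀_unique c ?_
      rw [← hqY.integral_eq, ← hψψ.integral_eq, ← integral_condExp hI']
      exact integral_congr_ae hcond
    subst hc
    have hle := integral_max_zero_sub_le_of_condExp_eq hI' hqi hcond y
    have hmeas : Measurable fun x : ℝ => max 0 (y - x) := by fun_prop
    rw [hsub, sub_nonneg]
    have e1 := (hqY.comp hmeas).integral_eq
    have e2 := (hψψ.comp hmeas).integral_eq
    simp only [Function.comp_def] at e1 e2
    rwa [← e1, ← e2]
  · intro h
    have hqY : Measurable fun ω => q (Y ω) c₀ := (hq c₀).comp hY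
    have hYprob : IsProbabilityMeasure (P.map Y) := Measure.isProbabilityMeasure_map hY.aemeasurable
    have hψprob : IsProbabilityMeasure (P.map ψ) := Measure.isProbabilityMeasure_map hψ.aemeasurable
    have hνprob : IsProbabilityMeasure (P.map fun ω => q (Y ω) c₀) :=
      Measure.isProbabilityMeasure_map hqY.aemeasurable
    obtain ⟨Γ, hΓ1, hΓ2, hΓ⟩ := exists_martingale_coupling (P.map ψ) (P.map fun ω => q (Y ω) c₀)
      ((integrable_map_measure (by fun_prop) hψ.aemeasurable).2 hψ_int)
      ((integrable_map_measure (by fun_prop) hqY.aemeasurable).2 (hq_int c₀))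
      (by
        rw [integral_map hψ.aemeasurable (by fun_prop),
          integral_map hqY.aemeasurable (by fun_prop)]
        exact hc₀)
      (fun y => by
        rw [integral_map hψ.aemeasurable (by fun_prop),
          integral_map hqY.aemeasurable (by fun_prop), ← sub_nonneg, ← hsub]
        exact h y)
    have hmap : (P.map Y).map (fun y => q y c₀) = P.map fun ω => q (Y ω) c₀ :=
      Measure.map_map (hq c₀) hY
    obtain ⟨P', hP', hP1, hP2⟩ :=
      exists_lift_of_map_eq_map_fst (P.map Y) (hq c₀) Γ (hΓ1.trans hmap.symm)
    have hsnd : P'.map Prod.snd = P.map ψ := by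
      rw [← hΓ2, ← hP2, Measure.map_map measurable_snd ((hq c₀).prodMap measurable_id)]
      rfl
    have hid1 : IdentDistrib Prod.fst Y P' P :=
      ⟨measurable_fst.aemeasurable, hY.aemeasurable, hP1⟩
    have hid2 : IdentDistrib Prod.snd ψ P' P :=
      ⟨measurable_snd.aemeasurable, hψ.aemeasurable, hsnd⟩
    -- The information is the smallest allowed, that generated by `ψ'`.
    refine ⟨ℝ × ℝ, MeasurableSpace.comap Prod.snd inferInstance, inferInstance, P', Prod.fst,
      Prod.snd, c₀, hP', measurable_fst, measurable_snd, le_rfl, measurable_snd.comap_le, hid1,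
      hid2, ?_⟩
    exact condExp_comap_snd_eq (hq c₀) ((hid1.comp (hq c₀)).integrable_iff.2 (hq_int c₀))
      (hid2.integrable_iff.2 hψ_int) (by rwa [hP2])
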